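/- Let $\mathcal X\subset\mathbb R^m$ with the Euclidean metric, let $f:\mathcal X\to\mathcal X$ be measurable, and let $\nu$ be an $f$-invariant ergodic Borel probability measure on $\mathcal X$ (for example an ergodic SRB measure). Write $B(x,r)$ for the ball of radius $r$ in $\mathcal X$ about $x$. Let $\tilde x\in\mathcal X$ be a point at which the local dimension $$d_\nu=\lim_{r\to0}\frac{\log\nu(B(\tilde x,r))}{\log r}$$ exists, with $0<d_\nu<\infty$, and assume (A2) there are $\delta>0$, $r_0>0$ and $C$ such that $|\nu(B(\tilde x,r+\epsilon))-\nu(B(\tilde x,r))|\le C\epsilon^\delta$ for all $0<\epsilon<r<r_0$. Let $\phi(x)=-\log\operatorname{dist}(x,\tilde x)$ and $M_n(x)=\max_{0\le i\le n-1}\phi(f^i(x))$. Say that (A1) holds with rate $\Theta$ if $\Theta(j)$ decreases monotonically to $0$ and, for all bounded Lipschitz functions $\varphi_1,\varphi_2:\mathcal X\to\mathbb R$ and all $j\ge 0$, $$\left|\int\varphi_1\cdot\varphi_2\circ f^j\,d\nu-\int\varphi_1\,d\nu\int\varphi_2\,d\nu\right|\le\Theta(j)\,\|\varphi_1\|_{\mathrm{Lip}}\|\varphi_2\|_{\mathrm{Lip}},$$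 where $\|\varphi\|_{\mathrm{Lip}}$ is the supremum norm plus the best Lipschitz constant of $\varphi$. 1. If (A1) holds with a rate $\Theta(n)=O(\theta_0^n)$ for some $\theta_0\in(0,1)$, then for $\nu$-almost every $x$ $$\lim_{n\to\infty}\frac{M_n(x)}{\log n}=\frac1{d_\nu}.$$ 2. If (A1) holds with a rate $\Theta(n)=O(n^{-\zeta})$ for some $\zeta>0$, then there is $\beta\in(0,1)$ such that for $\nu$-almost every $x$ $$\frac{\beta}{d_\nu}\le\liminf_{n\to\infty}\frac{M_n(x)}{\log n}\quad\text{and}\quad\limsup_{n\to\infty}\frac{M_n(x)}{\log n}\le\frac1{d_\nu}.$$ -/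

import Mathlib

open Filter Topology MeasureTheory Asymptotics

namespace MaxGrowth

noncomputable section

/-- `φ` is bounded and Lipschitz, i.e. an element of the Banach space of Lipschitz functions. -/
def IsBddLipschitz {α : Type*} [MetricSpace α] (φ : α → ℝ) : Prop :=
  (∃ C : ℝ, ∀ x, |φ x| ≤ C) ∧ ∃ K : ℝ, ∀ x y, |φ x - φ y| ≤ K * dist x y

/-- The best Lipschitz constant of `φ`. -/
def lipConst {α : Type*} [MetricSpace α] (φ : α → ℝ) : ℝ :=
  sInf {K : ℝ | 0 ≤ K ∧ ∀ x y, |φ x - φ y| ≤ K * dist x y}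

/-- The Lipschitz norm: supremum norm plus best Lipschitz constant. -/
def lipNorm {α : Type*} [MetricSpace α] (φ : α → ℝ) : ℝ :=
  (⨆ x, |φ x|) + lipConst φ

/-- The correlation `|∫ φ₁ · (φ₂ ∘ f^j) dν - ∫ φ₁ dν ∫ φ₂ dν|`. -/
def correlation {α : Type*} [MeasurableSpace α] (f : α → α) (ν : Measure α)
    (φ₁ φ₂ : α → ℝ) (j : ℕ) : ℝ :=
  |(∫ x, φ₁ x * φ₂ (f^[j] x) ∂ν) - (∫ x, φ₁ x ∂ν) * ∫ x, φ₂ x ∂ν|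

/-- Decay of correlations for Lipschitz functions with rate function `Θ`:
`Θ` decreases monotonically to `0` and bounds the correlations. -/
def LipschitzDecay {α : Type*} [MetricSpace α] [MeasurableSpace α] (f : α → α)
    (ν : Measure α) (Θ : ℕ → ℝ) : Prop :=
  Antitone Θ ∧ Tendsto Θ atTop (𝓝 0) ∧
    ∀ φ₁ φ₂ : α → ℝ, IsBddLipschitz φ₁ → IsBddLipschitz φ₂ →
      ∀ j : ℕ, correlation f ν φ₁ φ₂ j ≤ Θ j * lipNorm φ₁ * lipNorm φ₂

/-- The local dimension of `ν` at `x` exists and equals the real number `d`. All balls about `x`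
have positive measure (otherwise `log ν(B(x,r)) / log r` would be `+∞` for small `r`). -/
def HasLocalDim {α : Type*} [MetricSpace α] [MeasurableSpace α] (ν : Measure α)
    (x : α) (d : ℝ) : Prop :=
  (∀ r : ℝ, 0 < r → 0 < ν (Metric.closedBall x r)) ∧
    Tendsto (fun r : ℝ => Real.log (ν.real (Metric.closedBall x r)) / Real.log r)
      (𝓝[>] 0) (𝓝 d)

/-- Regularity of `ν` on shrinking annuli about `x`. -/
def AnnulusRegular {α : Type*} [MetricSpace α] [MeasurableSpace α] (ν : Measure α)
    (x : α) : Prop :=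
  ∃ δ r₀ C : ℝ, 0 < δ ∧ 0 < r₀ ∧ ∀ ε r : ℝ, 0 < ε → ε < r → r < r₀ →
    |ν.real (Metric.closedBall x (r + ε)) - ν.real (Metric.closedBall x r)| ≤ C * ε ^ δ

/-- The observable `φ(x) = -log dist(x, p)`; the value at `x = p` is immaterial
when `p` is not an atom. -/
def logObs {α : Type*} [MetricSpace α] (p : α) (x : α) : ℝ :=
  -Real.log (dist x p)

/-- The maximum process `M_n = max (X_1, …, X_n)`, where `X_i = φ ∘ f^(i-1)` (for `n ≥ 1`). -/
def maxProcess {α : Type*} (f : α → α) (φ : α → ℝ) (n : ℕ) (x : α) : ℝ :=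
  ⨆ i : Fin n, φ (f^[(i : ℕ)] x)

end

end MaxGrowth

/-! Both bounds are Borel–Cantelli arguments. Upper bound: by invariance, being within `n ^ (-b)` of
`p` at time `n` has probability at most about `n ^ (-b * d)`, which is summable for `b > 1 / d`.

Lower bound: the orbit must visit the ball of radius `N ^ (-a)` before time `N`. Replace the ball by
a Lipschitz bump of mean `μ` and apply Chebyshev to its sum along the orbit. Lags below `k` are
bounded trivially and the others by decay of correlations, so a miss has probability of order `k /
(N * μ) + Θ k / (r * μ) ^ 2` (`measureReal_forall_eq_zero_le`). With `k` about `N ^ κ` this is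
summable along `N = 2 ^ l`, and monotonicity of the maximum fills the dyadic gaps. Superpolynomial
decay allows every `a < 1 / d`; polynomial decay only some small `a`. -/

namespace MaxGrowth

/-! ### Lipschitz cutoffs of balls -/

section Bump

variable {α : Type*} [MetricSpace α]

/-- The bump that equals `1` on the ball of radius `r / 2` about `p` and vanishes off the ball of
radius `r`. -/
noncomputable def bump (p : α) (r : ℝ) (x : α) : ℝ := max 0 (min 1 (2 - 2 / r * dist x p))

lemma bump_nonneg (p : α) (r : ℝ) (x : α) : 0 ≤ bump p r x := le_max_left _ _

lemma bump_le_one (p : α) (r : ℝ) (x : α) : bump p r x ≤ 1 :=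
  max_le zero_le_one (min_le_left _ _)

lemma abs_bump_le_one (p : α) (r : ℝ) (x : α) : |bump p r x| ≤ 1 := by
  rw [abs_of_nonneg (bump_nonneg p r x)]
  exact bump_le_one p r x

lemma continuous_bump (p : α) (r : ℝ) : Continuous (bump p r) := by
  unfold bump
  fun_prop

lemma bump_eq_one {p : α} {r : ℝ} (hr : 0 < r) {x : α} (hx : dist x p ≤ r / 2) :
    bump p r x = 1 := by
  have h : 2 / r * dist x p ≤ 1 := by
    rw [div_mul_eq_mul_div, div_le_one hr]
    linarith
  unfold bump
  rw [min_eq_left (by linarith), max_eq_right zero_le_one]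

lemma bump_eq_zero {p : α} {r : ℝ} (hr : 0 < r) {x : α} (hx : r ≤ dist x p) :
    bump p r x = 0 := by
  have h : 2 ≤ 2 / r * dist x p := by
    rw [div_mul_eq_mul_div, le_div_iff₀ hr]
    linarith
  exact max_eq_left ((min_le_right _ _).trans (by linarith))

lemma abs_bump_sub_le (p : α) {r : ℝ} (hr : 0 < r) (x y : α) :
    |bump p r x - bump p r y| ≤ 2 / r * dist x y := by
  have h1 : |bump p r x - bump p r y| ≤
      |(2 - 2 / r * dist x p) - (2 - 2 / r * dist y p)| := by
    unfold bump
    refine (abs_max_sub_max_le_max _ _ _ _).trans ?_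
    rw [sub_self, abs_zero, max_eq_right (abs_nonneg _)]
    refine (abs_min_sub_min_le_max _ _ _ _).trans ?_
    rw [sub_self, abs_zero, max_eq_right (abs_nonneg _)]
  refine h1.trans ?_
  have h2 : (2 - 2 / r * dist x p) - (2 - 2 / r * dist y p) =
      2 / r * (dist y p - dist x p) := by ring
  rw [h2, abs_mul, abs_of_pos (by positivity : 0 < 2 / r)]
  gcongr
  rw [dist_comm x y]
  exact abs_dist_sub_le y x p

lemma isBddLipschitz_bump (p : α) {r : ℝ} (hr : 0 < r) : IsBddLipschitz (bump p r) :=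
  ⟨⟨1, abs_bump_le_one p r⟩, ⟨2 / r, abs_bump_sub_le p hr⟩⟩

lemma lipNorm_nonneg (φ : α → ℝ) : 0 ≤ lipNorm φ :=
  add_nonneg (Real.iSup_nonneg fun _ => abs_nonneg _) (Real.sInf_nonneg fun _ h => h.1)

lemma lipNorm_bump_le (p : α) {r : ℝ} (hr : 0 < r) (hr1 : r ≤ 1) :
    lipNorm (bump p r) ≤ 3 / r := by
  have : Nonempty α := ⟨p⟩
  have h1 : (⨆ x, |bump p r x|) ≤ 1 := ciSup_le (abs_bump_le_one p r)
  have h2 : lipConst (bump p r) ≤ 2 / r :=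
    csInf_le ⟨0, fun _ h => h.1⟩ ⟨by positivity, abs_bump_sub_le p hr⟩
  have h3 : 1 ≤ 1 / r := by rwa [le_div_iff₀ hr, one_mul]
  have h4 : 3 / r = 1 / r + 2 / r := by ring
  unfold lipNorm
  linarith

end Bump

/-! ### Power bounds on ball measures from the local dimension -/

section LocalDim

variable {α : Type*} [MetricSpace α] [MeasurableSpace α] {ν : Measure α} {p : α} {d : ℝ}

lemma HasLocalDim.eventually_rpow_le [IsFiniteMeasure ν] (hd : HasLocalDim ν p d) {e : ℝ}
    (he : d < e) : ∀ᶠ r in 𝓝[>] (0 : ℝ), r ^ e ≤ ν.real (Metric.closedBall p r) := by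
  filter_upwards [hd.2.eventually (eventually_lt_nhds he),
    Ioo_mem_nhdsGT (zero_lt_one : (0 : ℝ) < 1)] with r h ⟨h0, h1⟩
  have hν : 0 < ν.real (Metric.closedBall p r) :=
    ENNReal.toReal_pos (hd.1 r h0).ne' (measure_ne_top _ _)
  have hl := Real.log_neg h0 h1
  rw [div_lt_iff_of_neg hl] at h
  rw [← Real.log_le_log_iff (Real.rpow_pos_of_pos h0 e) hν, Real.log_rpow h0]
  exact h.le

lemma HasLocalDim.eventually_le_rpow [IsFiniteMeasure ν] (hd : HasLocalDim ν p d) {e : ℝ}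
    (he : e < d) : ∀ᶠ r in 𝓝[>] (0 : ℝ), ν.real (Metric.closedBall p r) ≤ r ^ e := by
  filter_upwards [hd.2.eventually (eventually_gt_nhds he),
    Ioo_mem_nhdsGT (zero_lt_one : (0 : ℝ) < 1)] with r h ⟨h0, h1⟩
  have hν : 0 < ν.real (Metric.closedBall p r) :=
    ENNReal.toReal_pos (hd.1 r h0).ne' (measure_ne_top _ _)
  have hl := Real.log_neg h0 h1
  rw [lt_div_iff_of_neg hl] at h
  rw [← Real.log_le_log_iff hν (Real.rpow_pos_of_pos h0 e), Real.log_rpow h0]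
  exact h.le

lemma HasLocalDim.measure_singleton [IsFiniteMeasure ν] (hd : HasLocalDim ν p d)
    (hd0 : 0 < d) : ν {p} = 0 := by
  have h1 : ν.real {p} ≤ 0 := by
    have ht : Tendsto (fun r : ℝ => r ^ (d / 2)) (𝓝[>] 0) (𝓝 0) := by
      have := (Real.continuousAt_rpow_const 0 (d / 2) (Or.inr (by positivity))).tendsto
      rw [Real.zero_rpow (by positivity)] at this
      exact this.mono_left nhdsWithin_le_nhds
    refine ge_of_tendsto ht ?_
    filter_upwards [hd.eventually_le_rpow (half_lt_self hd0), self_mem_nhdsWithin] with r h h0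
    refine (measureReal_mono ?_).trans h
    rintro _ rfl
    exact Metric.mem_closedBall_self (le_of_lt h0)
  have h2 : ν.real {p} = 0 := le_antisymm h1 measureReal_nonneg
  exact (measureReal_eq_zero_iff).1 h2

end LocalDim

/-! ### Deterministic facts on running maxima -/

section MaxProcess

variable {α : Type*} {f : α → α} {φ : α → ℝ}

lemma le_maxProcess {n i : ℕ} (hi : i < n) (x : α) :
    φ (f^[i] x) ≤ maxProcess f φ n x :=
  le_ciSup (f := fun i : Fin n => φ (f^[(i : ℕ)] x)) (Set.finite_range _).bddAbove ⟨i, hi⟩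

lemma maxProcess_le {n : ℕ} (hn : 0 < n) {x : α} {c : ℝ} (h : ∀ i < n, φ (f^[i] x) ≤ c) :
    maxProcess f φ n x ≤ c := by
  have : Nonempty (Fin n) := ⟨⟨0, hn⟩⟩
  exact ciSup_le fun i => h i i.2

lemma maxProcess_mono {n k : ℕ} (hn : 0 < n) (hnk : n ≤ k) (x : α) :
    maxProcess f φ n x ≤ maxProcess f φ k x :=
  maxProcess_le hn fun _ hi => le_maxProcess (hi.trans_le hnk) x

lemma eventually_maxProcess_le {b : ℝ} (hb : 0 < b) {x : α}
    (h : ∀ᶠ n : ℕ in atTop, φ (f^[n] x) ≤ b * Real.log n) :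
    ∀ᶠ n : ℕ in atTop, maxProcess f φ n x / Real.log n ≤ b := by
  obtain ⟨K, hK⟩ := eventually_atTop.1 h
  obtain ⟨C, hC⟩ := ((Set.finite_Iio K).image fun i => φ (f^[i] x)).bddAbove
  have hlog : Tendsto (fun n : ℕ => b * Real.log n) atTop atTop :=
    (Real.tendsto_log_atTop.comp tendsto_natCast_atTop_atTop).const_mul_atTop hb
  filter_upwards [hlog.eventually_ge_atTop C, eventually_ge_atTop 2] with n hn hn2
  have hlogn : 0 < Real.log n := Real.log_pos (by exact_mod_cast hn2)
  rw [div_le_iff₀ hlogn]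
  refine maxProcess_le (by omega) fun i hi => ?_
  by_cases hiK : i < K
  · exact (hC ⟨i, hiK, rfl⟩).trans hn
  · refine (hK i (not_lt.1 hiK)).trans ?_
    -- Time `0` is separate: `Real.log 0 = 0`, and monotonicity of `log` needs `0 < i`.
    rcases Nat.eq_zero_or_pos i with rfl | hi0
    · simpa using (mul_pos hb hlogn).le
    · gcongr

/-- Rounding `n` down to a power of two costs a factor `(l + 1) / l` in the logarithm, which the gap
between `b` and `a` absorbs once `l > b / (a - b)`. -/
lemma eventually_le_maxProcess_of_two_pow {a b : ℝ} (hb : 0 < b) (hba : b < a) {x : α}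
    (h : ∀ᶠ l : ℕ in atTop, a * Real.log ((2 : ℝ) ^ l) ≤ maxProcess f φ (2 ^ l) x) :
    ∀ᶠ n : ℕ in atTop, b ≤ maxProcess f φ n x / Real.log n := by
  have hlog2 : Tendsto (fun n : ℕ => Nat.log 2 n) atTop atTop :=
    tendsto_atTop.2 fun k => by
      filter_upwards [eventually_ge_atTop (2 ^ k)] with n hn
      exact Nat.le_log_of_pow_le one_lt_two hn
  obtain ⟨k, hk⟩ := exists_nat_gt (b / (a - b))
  filter_upwards [hlog2.eventually h, hlog2.eventually_ge_atTop k, eventually_ge_atTop 2]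
    with n hn hkn hn2
  have hlogn : 0 < Real.log n := Real.log_pos (by exact_mod_cast hn2)
  have hl2 : 0 < Real.log 2 := Real.log_pos one_lt_two
  rw [le_div_iff₀ hlogn]
  set l := Nat.log 2 n
  have h1 : maxProcess f φ (2 ^ l) x ≤ maxProcess f φ n x :=
    maxProcess_mono (by positivity) (Nat.pow_log_le_self 2 (by omega)) x
  have h2 : Real.log n ≤ (l + 1) * Real.log 2 := by
    have : (n : ℝ) ≤ 2 ^ (l + 1) := by
      exact_mod_cast (Nat.lt_pow_succ_log_self one_lt_two n).le
    have := Real.log_le_log (by positivity) this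
    rwa [Real.log_pow, Nat.cast_add, Nat.cast_one] at this
  have h3 : b * (l + 1) ≤ a * l := by
    have hkl : (k : ℝ) ≤ l := by exact_mod_cast hkn
    have := (div_lt_iff₀ (sub_pos.2 hba)).1 (hk.trans_le hkl)
    linarith
  rw [Real.log_pow] at hn
  calc b * Real.log n ≤ b * ((l + 1) * Real.log 2) := by gcongr
    _ = b * (l + 1) * Real.log 2 := by ring
    _ ≤ a * l * Real.log 2 := by gcongr
    _ = a * (l * Real.log 2) := by ring
    _ ≤ maxProcess f φ n x := hn.trans h1

end MaxProcess

/-! ### Upper bound by Borel–Cantelli -/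

section UpperBound

variable {α : Type*} [MetricSpace α] [MeasurableSpace α] [OpensMeasurableSpace α]
  {f : α → α} {ν : Measure α} [IsProbabilityMeasure ν] {p : α} {d : ℝ}

lemma ae_eventually_logObs_le (hf : MeasurePreserving f ν ν) (hd : HasLocalDim ν p d)
    (hd0 : 0 < d) {b : ℝ} (hb : 1 / d < b) :
    ∀ᵐ x ∂ν, ∀ᶠ n : ℕ in atTop, logObs p (f^[n] x) ≤ b * Real.log n := by
  have hb0 : 0 < b := (one_div_pos.2 hd0).trans hb
  -- An exponent below `d` that still has `b * e > 1`, for summability.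
  obtain ⟨e, he1, he2⟩ : ∃ e, 1 / b < e ∧ e < d :=
    exists_between (by rwa [one_div_lt hb0 hd0])
  have hbe : 1 < b * e := by
    rw [div_lt_iff₀ hb0] at he1
    linarith
  have hr : Tendsto (fun n : ℕ => (n : ℝ) ^ (-b)) atTop (𝓝[>] 0) := by
    refine tendsto_nhdsWithin_iff.2
      ⟨(tendsto_rpow_neg_atTop hb0).comp tendsto_natCast_atTop_atTop, ?_⟩
    filter_upwards [eventually_gt_atTop 0] with n hn
    exact Real.rpow_pos_of_pos (by exact_mod_cast hn) _
  have hsum : Summable fun n : ℕ => ν.real (f^[n] ⁻¹' Metric.closedBall p ((n : ℝ) ^ (-b))) := by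
    refine Summable.of_norm_bounded_eventually_nat
      (Real.summable_nat_rpow_inv.2 hbe) ?_
    filter_upwards [hr.eventually (hd.eventually_le_rpow he2)] with n hn
    rw [Real.norm_of_nonneg measureReal_nonneg, measureReal_def,
      (hf.iterate n).measure_preimage Metric.isClosed_closedBall.measurableSet.nullMeasurableSet]
    refine hn.trans_eq ?_
    rw [← Real.rpow_mul (Nat.cast_nonneg n), ← Real.rpow_neg (Nat.cast_nonneg n), neg_mul]
  have hfin : ∑' n : ℕ, ν (f^[n] ⁻¹' Metric.closedBall p ((n : ℝ) ^ (-b))) ≠ ⊤ := by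
    have := hsum.tsum_ofReal_ne_top
    simpa only [ofReal_measureReal (measure_ne_top ν _)] using this
  filter_upwards [ae_eventually_notMem hfin] with x hx
  filter_upwards [hx, eventually_gt_atTop 0] with n hn hn0
  have hn0' : (0 : ℝ) < n := by exact_mod_cast hn0
  simp only [Set.mem_preimage, Metric.mem_closedBall, not_le] at hn
  have := Real.log_le_log (Real.rpow_pos_of_pos hn0' _) hn.le
  rw [Real.log_rpow hn0'] at this
  unfold logObs
  linarith

lemma ae_eventually_maxProcess_le (hf : MeasurePreserving f ν ν) (hd : HasLocalDim ν p d)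
    (hd0 : 0 < d) : ∀ᵐ x ∂ν, ∀ b > 1 / d, ∀ᶠ n : ℕ in atTop,
      maxProcess f (logObs p) n x / Real.log n ≤ b := by
  -- Countably many thresholds give a null set independent of `b`.
  have h : ∀ᵐ x ∂ν, ∀ k : ℕ, ∀ᶠ n : ℕ in atTop,
      maxProcess f (logObs p) n x / Real.log n ≤ 1 / d + 1 / (k + 1) := by
    refine ae_all_iff.2 fun k => ?_
    have hk : (0 : ℝ) < 1 / (k + 1) := Nat.one_div_pos_of_nat
    filter_upwards [ae_eventually_logObs_le hf hd hd0 (lt_add_of_pos_right (1 / d) hk)] with x hx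
    exact eventually_maxProcess_le (by positivity) hx
  filter_upwards [h] with x hx b hb
  obtain ⟨k, hk⟩ := exists_nat_one_div_lt (sub_pos.2 hb)
  filter_upwards [hx k] with n hn
  linarith

end UpperBound

/-! ### Second moment method for stationary observables -/

section SecondMoment

variable {α : Type*} [MeasurableSpace α] {f : α → α} {ν : Measure α} {ψ : α → ℝ}

lemma integral_comp_iterate (hf : MeasurePreserving f ν ν) {g : α → ℝ} (hg : Measurable g)
    (i : ℕ) : ∫ x, g (f^[i] x) ∂ν = ∫ x, g x ∂ν := by
  have hi := hf.iterate i
  calc ∫ x, g (f^[i] x) ∂ν = ∫ y, g y ∂(ν.map f^[i]) :=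
        (integral_map hi.measurable.aemeasurable hg.aestronglyMeasurable).symm
    _ = ∫ x, g x ∂ν := by rw [hi.map_eq]

lemma integrable_of_bounds [IsFiniteMeasure ν] {g : α → ℝ} (hg : Measurable g) {C : ℝ} (h : ∀ x, |g x| ≤ C) :
    Integrable g ν :=
  Integrable.of_bound hg.aestronglyMeasurable C (Eventually.of_forall h)

lemma integral_iterate_mul_iterate_le (hf : MeasurePreserving f ν ν) (hψ : Measurable ψ)
    {c : ℕ → ℝ} (hc : ∀ j, ∫ x, ψ x * ψ (f^[j] x) ∂ν ≤ c j) (i j : ℕ) :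
    ∫ x, ψ (f^[i] x) * ψ (f^[j] x) ∂ν ≤ c (Nat.dist i j) := by
  wlog hij : i ≤ j generalizing i j
  · rw [Nat.dist_comm]
    simpa only [mul_comm] using this j i (le_of_not_ge hij)
  · rw [Nat.dist_eq_sub_of_le hij]
    refine le_trans (le_of_eq ?_) (hc (j - i))
    rw [← integral_comp_iterate hf (g := fun x => ψ x * ψ (f^[j - i] x))
      (hψ.mul (hψ.comp (hf.iterate _).measurable)) i]
    simp only [← Function.iterate_add_apply, Nat.sub_add_cancel hij]

lemma card_dist_lt_le (N k i : ℕ) :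
    ((Finset.range N).filter fun j => Nat.dist i j < k).card ≤ 2 * k := by
  have hsub : ((Finset.range N).filter fun j => Nat.dist i j < k) ⊆
      Finset.Ico (i + 1 - k) (i + k) := by
    intro j hj
    have hjk := (Finset.mem_filter.1 hj).2
    rw [Nat.dist] at hjk
    rw [Finset.mem_Ico]
    omega
  refine (Finset.card_le_card hsub).trans ?_
  rw [Nat.card_Ico]
  omega

/-- Second moment bound for the probability that a `[0, 1]`-valued observable vanishes along an
orbit segment, when its correlations are at most `ε` from lag `k` on. -/
lemma measureReal_forall_eq_zero_le [IsProbabilityMeasure ν] (hf : MeasurePreserving f ν ν) (hψ : Measurable ψ)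
    (h0 : ∀ x, 0 ≤ ψ x) (h1 : ∀ x, ψ x ≤ 1) (hpos : 0 < ∫ x, ψ x ∂ν) {k : ℕ} {ε : ℝ}
    (hε : 0 ≤ ε) (hcor : ∀ j ≥ k, correlation f ν ψ ψ j ≤ ε) {N : ℕ} (hN : 0 < N) :
    ν.real {x | ∀ i < N, ψ (f^[i] x) = 0} ≤
      2 * k / (N * ∫ x, ψ x ∂ν) + ε / (∫ x, ψ x ∂ν) ^ 2 := by
  set μ := ∫ x, ψ x ∂ν with hμ
  have hm : ∀ i, Measurable fun x => ψ (f^[i] x) := fun i => hψ.comp (hf.iterate i).measurable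
  have habs : ∀ x, |ψ x| ≤ 1 := fun x => by rw [abs_of_nonneg (h0 x)]; exact h1 x
  have hint : ∀ i, Integrable (fun x => ψ (f^[i] x)) ν := fun i =>
    integrable_of_bounds (hm i) fun x => habs _
  have hint2 : ∀ i j, Integrable (fun x => ψ (f^[i] x) * ψ (f^[j] x)) ν := fun i j =>
    integrable_of_bounds (C := 1) ((hm i).mul (hm j)) fun x => by
      rw [abs_mul]
      exact mul_le_one₀ (habs _) (abs_nonneg _) (habs _)
  -- At short lags `ψ ≤ 1` bounds the product by `ψ`; adding `ε + μ ^ 2` there too makes only the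
  -- first term depend on the lag.
  have hc : ∀ j, ∫ x, ψ x * ψ (f^[j] x) ∂ν ≤ (if j < k then μ else 0) + ε + μ ^ 2 := by
    intro j
    split_ifs with hj
    · have : ∫ x, ψ x * ψ (f^[j] x) ∂ν ≤ μ :=
        integral_mono (hint2 0 j) (hint 0) fun x => mul_le_of_le_one_right (h0 _) (h1 _)
      nlinarith [sq_nonneg μ]
    · have := (le_abs_self _).trans (hcor j (not_lt.1 hj))
      rw [← hμ] at this
      linarith [sq μ]
  set S : α → ℝ := fun x => ∑ i ∈ Finset.range N, ψ (f^[i] x) with hS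
  have hSint : Integrable S ν := integrable_finsetSum _ fun i _ => hint i
  have hSS : ∀ x, S x ^ 2 = ∑ i ∈ Finset.range N, ∑ j ∈ Finset.range N,
      ψ (f^[i] x) * ψ (f^[j] x) := fun x => by
    rw [hS, sq, Finset.sum_mul_sum]
  have hSSint : Integrable (fun x => S x ^ 2) ν := by
    simp only [hSS]
    exact integrable_finsetSum _ fun i _ => integrable_finsetSum _ fun j _ => hint2 i j
  have hES : ∫ x, S x ∂ν = N * μ := by
    rw [hS, integral_finsetSum _ fun i _ => hint i]
    simp only [integral_comp_iterate hf hψ, Finset.sum_const, Finset.card_range, nsmul_eq_mul]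
    rfl
  have hESS : ∫ x, S x ^ 2 ∂ν ≤ 2 * k * N * μ + N ^ 2 * ε + N ^ 2 * μ ^ 2 := by
    simp only [hSS]
    rw [integral_finsetSum _ fun i _ => integrable_finsetSum _ fun j _ => hint2 i j]
    have hrow : ∀ i ∈ Finset.range N,
        ∫ x, ∑ j ∈ Finset.range N, ψ (f^[i] x) * ψ (f^[j] x) ∂ν ≤
          2 * k * μ + N * ε + N * μ ^ 2 := by
      intro i _
      rw [integral_finsetSum _ fun j _ => hint2 i j]
      refine (Finset.sum_le_sum fun j _ => integral_iterate_mul_iterate_le hf hψ hc i j).trans ?_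
      rw [Finset.sum_add_distrib, Finset.sum_add_distrib, ← Finset.sum_filter]
      simp only [Finset.sum_const, Finset.card_range, nsmul_eq_mul]
      have hcard : (((Finset.range N).filter fun j => Nat.dist i j < k).card : ℝ) ≤ 2 * k := by
        exact_mod_cast card_dist_lt_le N k i
      gcongr
    refine (Finset.sum_le_sum hrow).trans_eq ?_
    simp only [Finset.sum_const, Finset.card_range, nsmul_eq_mul]
    ring
  have hexp : ∀ x, (S x - N * μ) ^ 2 = S x ^ 2 - 2 * (N * μ) * S x + (N * μ) ^ 2 := fun x => by
    ring
  have hVint : Integrable (fun x => (S x - N * μ) ^ 2) ν := by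
    simp only [hexp]
    exact (hSSint.sub (hSint.const_mul _)).add (integrable_const _)
  have hV : ∫ x, (S x - N * μ) ^ 2 ∂ν ≤ 2 * k * N * μ + N ^ 2 * ε := by
    simp only [hexp]
    rw [integral_add (f := fun x => S x ^ 2 - 2 * (N * μ) * S x)
      (hSSint.sub (hSint.const_mul _)) (integrable_const _),
      integral_sub hSSint (hSint.const_mul _), integral_const_mul, hES, integral_const]
    simp only [probReal_univ, smul_eq_mul, one_mul]
    linarith
  have hMarkov := mul_meas_ge_le_integral_of_nonneg
    (Eventually.of_forall fun x => sq_nonneg (S x - N * μ)) hVint ((N * μ) ^ 2)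
  -- Without a visit `S` is `0`, hence deviates from its mean by all of `N * μ`.
  have hsub : {x | ∀ i < N, ψ (f^[i] x) = 0} ⊆ {x | (N * μ) ^ 2 ≤ (S x - N * μ) ^ 2} := by
    intro x hx
    have : S x = 0 := Finset.sum_eq_zero fun i hi => hx i (Finset.mem_range.1 hi)
    simp [this]
  have hN' : (0 : ℝ) < N := by exact_mod_cast hN
  have hle : (N * μ) ^ 2 * ν.real {x | ∀ i < N, ψ (f^[i] x) = 0} ≤
      2 * k * N * μ + N ^ 2 * ε :=
    (mul_le_mul_of_nonneg_left (measureReal_mono hsub) (sq_nonneg _)).trans (hMarkov.trans hV)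
  have heq : 2 * k / (N * μ) + ε / μ ^ 2 = (2 * k * N * μ + N ^ 2 * ε) / (N * μ) ^ 2 := by
    field_simp
  rw [heq, le_div_iff₀ (by positivity)]
  linarith

end SecondMoment

lemma LipschitzDecay.nonneg {α : Type*} [MetricSpace α] [MeasurableSpace α] {f : α → α}
    {ν : Measure α} {Θ : ℕ → ℝ} (h : LipschitzDecay f ν Θ) (n : ℕ) : 0 ≤ Θ n :=
  h.1.le_of_tendsto h.2.1 n

/-! ### Lower bound from decay of correlations -/

section LowerBound

variable {α : Type*} [MetricSpace α] [MeasurableSpace α] [OpensMeasurableSpace α]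
  {f : α → α} {ν : Measure α} [IsProbabilityMeasure ν] {p : α} {d : ℝ} {Θ : ℕ → ℝ}

lemma measureReal_le_integral_bump (p : α) {r : ℝ} (hr : 0 < r) :
    ν.real (Metric.closedBall p (r / 2)) ≤ ∫ x, bump p r x ∂ν := by
  have hB : MeasurableSet (Metric.closedBall p (r / 2)) :=
    Metric.isClosed_closedBall.measurableSet
  rw [← integral_indicator_one hB]
  refine integral_mono ((integrable_const 1).indicator hB)
    (integrable_of_bounds (continuous_bump p r).measurable (abs_bump_le_one p r)) fun x => ?_
  by_cases hx : x ∈ Metric.closedBall p (r / 2)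
  · rw [Set.indicator_of_mem hx, bump_eq_one hr hx]
    rfl
  · rw [Set.indicator_of_notMem hx]
    exact bump_nonneg p r x

lemma measureReal_forall_bump_eq_zero_le (hf : MeasurePreserving f ν ν)
    (hΘ : LipschitzDecay f ν Θ) {r : ℝ} (hr : 0 < r) (hr1 : r ≤ 1) {w : ℝ} (hw : 0 < w)
    (hball : w ≤ ν.real (Metric.closedBall p (r / 2))) (k : ℕ) {N : ℕ} (hN : 0 < N) :
    ν.real {x | ∀ i < N, bump p r (f^[i] x) = 0} ≤
      2 * k / (N * w) + Θ k * (3 / r) ^ 2 / w ^ 2 := by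
  have hwμ := hball.trans (measureReal_le_integral_bump (ν := ν) p hr)
  have hN' : (0 : ℝ) < N := by exact_mod_cast hN
  have hΘk := hΘ.nonneg k
  refine (measureReal_forall_eq_zero_le hf (continuous_bump p r).measurable (bump_nonneg p r)
    (bump_le_one p r) (hw.trans_le hwμ) (k := k) (ε := Θ k * (3 / r) ^ 2) (by positivity)
    (fun j hj => ?_) hN).trans ?_
  · have hL := isBddLipschitz_bump p hr
    refine (hΘ.2.2 _ _ hL hL j).trans ?_
    have h1 := lipNorm_bump_le p hr hr1
    have h2 := lipNorm_nonneg (bump p r)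
    have h3 := hΘ.1 hj
    rw [mul_assoc, sq]
    gcongr
  · gcongr

/-- With `M = 2 ^ l`, radius `M ^ (-a)` and lag about `M ^ κ`, `h1` and `h2` say that the two terms
of the miss probability have negative exponents in `M`. -/
lemma ae_eventually_le_maxProcess_two_pow (hf : MeasurePreserving f ν ν)
    (hd : HasLocalDim ν p d) (hd0 : 0 < d) (hΘ : LipschitzDecay f ν Θ) {z : ℝ} (hz : 0 < z)
    (hO : Θ =O[atTop] fun n : ℕ => (n : ℝ) ^ (-z)) {a e κ : ℝ} (ha : 0 < a) (hκ : 0 < κ)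
    (hde : d < e) (h1 : a * e + κ < 1) (h2 : 2 * a + 2 * (a * e) < z * κ) :
    ∀ᵐ x ∂ν, ∀ᶠ l : ℕ in atTop,
      a * Real.log ((2 : ℝ) ^ l) ≤ maxProcess f (logObs p) (2 ^ l) x := by
  obtain ⟨C, hC0, hC⟩ := hO.exists_pos
  have hC := hC.bound
  have hN : Tendsto (fun l : ℕ => (2 : ℝ) ^ l) atTop atTop :=
    tendsto_pow_atTop_atTop_of_one_lt one_lt_two
  have hk : Tendsto (fun l : ℕ => ⌈((2 : ℝ) ^ l) ^ κ⌉₊) atTop atTop :=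
    tendsto_nat_ceil_atTop.comp ((tendsto_rpow_atTop hκ).comp hN)
  have hr : Tendsto (fun l : ℕ => ((2 : ℝ) ^ l) ^ (-a) / 2) atTop (𝓝[>] 0) := by
    refine tendsto_nhdsWithin_iff.2 ⟨?_, Eventually.of_forall fun l => ?_⟩
    · simpa using ((tendsto_rpow_neg_atTop ha).comp hN).div_const 2
    · simp only [Set.mem_Ioi]
      positivity
  set A : ℕ → Set α := fun l => {x | ∀ i < 2 ^ l, bump p (((2 : ℝ) ^ l) ^ (-a)) (f^[i] x) = 0}
  have hpow : ∀ (s : ℝ) (l : ℕ), ((2 : ℝ) ^ l) ^ s = ((2 : ℝ) ^ s) ^ l := fun s l => by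
    rw [← Real.rpow_natCast, ← Real.rpow_mul zero_le_two, mul_comm, Real.rpow_mul zero_le_two,
      Real.rpow_natCast]
  have hgeo : ∀ s : ℝ, s < 0 → Summable fun l : ℕ => ((2 : ℝ) ^ l) ^ s := fun s hs => by
    simp only [hpow]
    exact summable_geometric_of_lt_one (by positivity) (Real.rpow_lt_one_of_one_lt_of_neg
      one_lt_two hs)
  have hsum : Summable fun l : ℕ => ν.real (A l) := by
    refine Summable.of_norm_bounded_eventually_nat
      (g := fun l : ℕ => 4 * 2 ^ e * ((2 : ℝ) ^ l) ^ (a * e + κ - 1) +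
        9 * C * (2 ^ e) ^ 2 * ((2 : ℝ) ^ l) ^ (2 * a + 2 * (a * e) - z * κ))
      (((hgeo _ (by linarith)).mul_left _).add ((hgeo _ (by linarith)).mul_left _)) ?_
    filter_upwards [hr.eventually (hd.eventually_rpow_le hde), hk.eventually hC]
      with l hl hCl
    rw [Real.norm_of_nonneg measureReal_nonneg]
    have hN1 : (1 : ℝ) ≤ 2 ^ l := one_le_pow₀ one_le_two
    set M : ℝ := 2 ^ l with hM
    have hM0 : 0 < M := by positivity
    have hMκ : 1 ≤ M ^ κ := Real.one_le_rpow hN1 hκ.le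
    have hkle : (⌈M ^ κ⌉₊ : ℝ) ≤ 2 * M ^ κ := by
      have := (Nat.ceil_lt_add_one (by positivity : 0 ≤ M ^ κ)).le
      linarith
    have hΘle : Θ ⌈M ^ κ⌉₊ ≤ C * M ^ (-(z * κ)) := by
      refine (le_abs_self _).trans (hCl.trans ?_)
      rw [Real.norm_of_nonneg (by positivity)]
      gcongr
      calc (⌈M ^ κ⌉₊ : ℝ) ^ (-z) ≤ (M ^ κ) ^ (-z) :=
            Real.rpow_le_rpow_of_nonpos (by positivity) (Nat.le_ceil _) (by linarith)
        _ = M ^ (-(z * κ)) := by rw [← Real.rpow_mul hM0.le]; ring_nf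
    have hw : (M ^ (-a) / 2) ^ e = M ^ (-(a * e)) / 2 ^ e := by
      rw [Real.div_rpow (by positivity) zero_le_two, ← Real.rpow_mul hM0.le, neg_mul]
    have hr1 : M ^ (-a) ≤ 1 := Real.rpow_le_one_of_one_le_of_nonpos hN1 (by linarith)
    refine (measureReal_forall_bump_eq_zero_le hf hΘ (by positivity) hr1
      (by positivity : 0 < (M ^ (-a) / 2) ^ e) hl ⌈M ^ κ⌉₊ (N := 2 ^ l) (by positivity)).trans ?_
    have hcast : ((2 ^ l : ℕ) : ℝ) = M := by rw [hM]; norm_cast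
    rw [hcast, hw]
    refine add_le_add ?_ ?_
    · calc 2 * (⌈M ^ κ⌉₊ : ℝ) / (M * (M ^ (-(a * e)) / 2 ^ e))
          ≤ 2 * (2 * M ^ κ) / (M * (M ^ (-(a * e)) / 2 ^ e)) := by gcongr
        _ = 4 * 2 ^ e * M ^ (a * e + κ - 1) := by
          rw [Real.rpow_sub hM0, Real.rpow_add hM0, Real.rpow_neg hM0.le, Real.rpow_one]
          field_simp
          ring
    · calc Θ ⌈M ^ κ⌉₊ * (3 / M ^ (-a)) ^ 2 / (M ^ (-(a * e)) / 2 ^ e) ^ 2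
          ≤ C * M ^ (-(z * κ)) * (3 / M ^ (-a)) ^ 2 / (M ^ (-(a * e)) / 2 ^ e) ^ 2 := by gcongr
        _ = 9 * C * (2 ^ e) ^ 2 * M ^ (2 * a + 2 * (a * e) - z * κ) := by
          rw [Real.rpow_sub hM0, Real.rpow_add hM0, two_mul a, two_mul (a * e),
            Real.rpow_add hM0, Real.rpow_add hM0, Real.rpow_neg hM0.le, Real.rpow_neg hM0.le,
            Real.rpow_neg hM0.le]
          field_simp
          ring
  have hfin : ∑' l : ℕ, ν (A l) ≠ ⊤ := by
    have := hsum.tsum_ofReal_ne_top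
    simpa only [ofReal_measureReal (measure_ne_top ν _)] using this
  -- At `p` itself `logObs` takes the default value `0`, so a hit on `p` would not count as a close
  -- visit.
  have hne : ∀ᵐ x ∂ν, ∀ i : ℕ, f^[i] x ≠ p := by
    refine ae_all_iff.2 fun i => ?_
    have : ∀ᵐ y ∂ν, y ≠ p := by
      rw [ae_iff]
      simpa using hd.measure_singleton hd0
    exact (hf.iterate i).quasiMeasurePreserving.ae this
  filter_upwards [ae_eventually_notMem hfin, hne] with x hx hxp
  filter_upwards [hx] with l hl
  simp only [A, Set.mem_ofPred_eq, not_forall] at hl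
  obtain ⟨i, hi, hb⟩ := hl
  refine le_trans ?_ (le_maxProcess hi x)
  have hM0 : (0 : ℝ) < 2 ^ l := by positivity
  have hdist : dist (f^[i] x) p < ((2 : ℝ) ^ l) ^ (-a) := by
    by_contra! hcon
    exact hb (bump_eq_zero (by positivity) hcon)
  have := Real.log_le_log (dist_pos.2 (hxp i)) hdist.le
  rw [Real.log_rpow hM0] at this
  unfold logObs
  linarith

lemma ae_eventually_le_maxProcess_of_superpolynomial (hf : MeasurePreserving f ν ν)
    (hd : HasLocalDim ν p d) (hd0 : 0 < d) (hΘ : LipschitzDecay f ν Θ)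
    (hO : ∀ z : ℝ, 0 < z → Θ =O[atTop] fun n : ℕ => (n : ℝ) ^ (-z)) {b : ℝ} (hb0 : 0 < b)
    (hb : b < 1 / d) :
    ∀ᵐ x ∂ν, ∀ᶠ n : ℕ in atTop, b ≤ maxProcess f (logObs p) n x / Real.log n := by
  obtain ⟨a, hba, had⟩ := exists_between hb
  have ha0 := hb0.trans hba
  obtain ⟨e, hde, hea⟩ : ∃ e, d < e ∧ e < 1 / a :=
    exists_between (by rwa [lt_one_div hd0 ha0])
  have he0 := hd0.trans hde
  have hae : a * e < 1 := by
    rw [lt_div_iff₀ ha0] at hea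
    linarith
  -- The exponents become `-κ` and, by the choice of `z`, `-1`.
  set κ := (1 - a * e) / 2 with hκ
  have hκ0 : 0 < κ := by
    rw [hκ]
    linarith
  set z := (2 * a + 2 * (a * e) + 1) / κ with hz
  have hz0 : 0 < z := by positivity
  have hzκ : z * κ = 2 * a + 2 * (a * e) + 1 := div_mul_cancel₀ _ hκ0.ne'
  filter_upwards [ae_eventually_le_maxProcess_two_pow hf hd hd0 hΘ hz0 (hO z hz0) ha0 hκ0 hde
    (by rw [hκ]; linarith) (by linarith)] with x hx
  exact eventually_le_maxProcess_of_two_pow hb0 hba hx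

lemma exists_ae_eventually_le_maxProcess (hf : MeasurePreserving f ν ν)
    (hd : HasLocalDim ν p d) (hd0 : 0 < d) (hΘ : LipschitzDecay f ν Θ) {z : ℝ} (hz : 0 < z)
    (hO : Θ =O[atTop] fun n : ℕ => (n : ℝ) ^ (-z)) :
    ∃ β : ℝ, 0 < β ∧ β < 1 ∧
      ∀ᵐ x ∂ν, ∀ᶠ n : ℕ in atTop, β / d ≤ maxProcess f (logObs p) n x / Real.log n := by
  -- The two entries of the minimum are the two exponent conditions for `κ = 1 / 2`, `e = 2 * d`.
  -- Below, halving `a` leaves room for the dyadic interpolation.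
  obtain ⟨a, ha0, ha⟩ : ∃ a : ℝ, 0 < a ∧ a < min (1 / (4 * d)) (z / (4 * (1 + 2 * d))) :=
    exists_between (by positivity)
  have ha1 := ha.trans_le (min_le_left _ _)
  have ha2 := ha.trans_le (min_le_right _ _)
  rw [lt_div_iff₀ (by positivity)] at ha1 ha2
  refine ⟨a * d / 2, by positivity, by linarith, ?_⟩
  filter_upwards [ae_eventually_le_maxProcess_two_pow hf hd hd0 hΘ hz hO ha0
    (κ := 1 / 2) (e := 2 * d) (by norm_num) (by linarith) (by linarith) (by linarith)] with x hx
  have heq : a * d / 2 / d = a / 2 := by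
    field_simp
  rw [heq]
  exact eventually_le_maxProcess_of_two_pow (half_pos ha0) (half_lt_self ha0) hx

end LowerBound

lemma pow_isBigO_rpow_neg {θ : ℝ} (h0 : 0 < θ) (h1 : θ < 1) (z : ℝ) :
    (fun n : ℕ => θ ^ n) =O[atTop] fun n : ℕ => (n : ℝ) ^ (-z) := by
  have h := (isLittleO_exp_neg_mul_rpow_atTop (neg_pos.2 (Real.log_neg h0 h1)) (-z)).isBigO
    |>.comp_tendsto tendsto_natCast_atTop_atTop
  refine h.congr_left fun n => ?_
  simp only [Function.comp_apply, neg_neg]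
  rw [mul_comm, Real.exp_nat_mul, Real.exp_log h0]

end MaxGrowth

theorem theorem2p1 {m : ℕ} (X : Set (EuclideanSpace ℝ (Fin m))) (f : X → X)
    (ν : Measure X) [IsProbabilityMeasure ν] (hf : Ergodic f ν)
    (p : X) (d : ℝ) (hd : MaxGrowth.HasLocalDim ν p d) (hd_pos : 0 < d)
    (hreg : MaxGrowth.AnnulusRegular ν p) :
    (∀ (Θ : ℕ → ℝ) (θ₀ : ℝ), MaxGrowth.LipschitzDecay f ν Θ → 0 < θ₀ → θ₀ < 1 →
      Θ =O[atTop] (fun n : ℕ => θ₀ ^ n) →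
        ∀ᵐ x ∂ν, Tendsto
          (fun n : ℕ => MaxGrowth.maxProcess f (MaxGrowth.logObs p) n x / Real.log n)
          atTop (𝓝 (1 / d))) ∧
    (∀ (Θ : ℕ → ℝ) (ζ : ℝ), MaxGrowth.LipschitzDecay f ν Θ → 0 < ζ →
      Θ =O[atTop] (fun n : ℕ => (n : ℝ) ^ (-ζ)) →
        ∃ β : ℝ, 0 < β ∧ β < 1 ∧ ∀ᵐ x ∂ν,
          ((β / d : ℝ) : EReal) ≤ liminf (fun n : ℕ =>
            ((MaxGrowth.maxProcess f (MaxGrowth.logObs p) n x / Real.log n : ℝ) : EReal))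
              atTop ∧
          limsup (fun n : ℕ =>
            ((MaxGrowth.maxProcess f (MaxGrowth.logObs p) n x / Real.log n : ℝ) : EReal))
              atTop ≤ ((1 / d : ℝ) : EReal)) := by
  have hmp := hf.toMeasurePreserving
  have hupper := MaxGrowth.ae_eventually_maxProcess_le hmp hd hd_pos
  constructor
  · intro Θ θ₀ hΘ h0 h1 hO
    -- The shift `k + 2` keeps every threshold positive, including `k = 0`.
    have hlower : ∀ᵐ x ∂ν, ∀ k : ℕ, ∀ᶠ n : ℕ in atTop,
        1 / d * (1 - 1 / (k + 2)) ≤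
          MaxGrowth.maxProcess f (MaxGrowth.logObs p) n x / Real.log n := by
      refine ae_all_iff.2 fun k => ?_
      have hk : (1 : ℝ) / (k + 2) < 1 := by
        rw [div_lt_one (by positivity)]
        linarith [(Nat.cast_nonneg k : (0 : ℝ) ≤ k)]
      have hk0 : (0 : ℝ) < 1 / (k + 2) := by positivity
      have hd' : 0 < 1 / d := by positivity
      exact MaxGrowth.ae_eventually_le_maxProcess_of_superpolynomial hmp hd hd_pos hΘ
        (fun z _ => hO.trans (MaxGrowth.pow_isBigO_rpow_neg h0 h1 z))
        (mul_pos hd' (by linarith)) (mul_lt_of_lt_one_right hd' (by linarith))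
    filter_upwards [hupper, hlower] with x hu hl
    refine tendsto_order.2 ⟨fun b hb => ?_, fun b hb => ?_⟩
    · have ht : Tendsto (fun k : ℕ => 1 / d * (1 - 1 / ((k : ℝ) + 2))) atTop (𝓝 (1 / d)) := by
        have h : Tendsto (fun k : ℕ => 1 / ((k : ℝ) + 2)) atTop (𝓝 0) :=
          tendsto_const_nhds.div_atTop
            (tendsto_atTop_add_const_right _ _ tendsto_natCast_atTop_atTop)
        simpa using (h.const_sub 1).const_mul (1 / d)
      obtain ⟨k, hk⟩ := (ht.eventually (eventually_gt_nhds hb)).exists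
      exact (hl k).mono fun n hn => hk.trans_le hn
    · obtain ⟨c, hc, hcb⟩ := exists_between hb
      exact (hu c hc).mono fun n hn => hn.trans_lt hcb
  · intro Θ ζ hΘ hζ hO
    obtain ⟨β, hβ0, hβ1, hβ⟩ :=
      MaxGrowth.exists_ae_eventually_le_maxProcess hmp hd hd_pos hΘ hζ hO
    refine ⟨β, hβ0, hβ1, ?_⟩
    filter_upwards [hupper, hβ] with x hu hl
    refine ⟨le_liminf_of_le (by isBoundedDefault) (hl.mono fun n hn => EReal.coe_le_coe_iff.2 hn),
      EReal.le_of_forall_lt_iff_le.1 fun b hb => ?_⟩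
    exact limsup_le_of_le (by isBoundedDefault)
      ((hu b (EReal.coe_lt_coe_iff.1 hb)).mono fun n hn => EReal.coe_le_coe_iff.2 hn)
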